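/- Let $G$ be a finite simple connected graph and let $X\subseteq V(G)$. Two vertices $x,y$ of $G$ are called $X$-visible if there is a shortest $x,y$-path in $G$ none of whose internal vertices belongs to $X$. The set $X$ is a dual mutual-visibility set of $G$ if any two vertices of $X$ are $X$-visible and any two vertices of $V(G)\setminus X$ are $X$-visible. The dual visibility polynomial of $G$ is $\sum_{i\ge 0} r_i x^i$, where $r_i$ is the number of dual mutual-visibility sets of $G$ of cardinality $i$. Every polynomial with nonnegative integer coefficients and with constant term $1$ is the dual visibility polynomial of some finite simple connected graph. -/

import Mathlib

namespace SimpleGraph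

/-- `x` and `y` are `X`-visible: some shortest `x,y`-path has no internal vertex in `X`. -/
def IsVisible {V : Type*} (G : SimpleGraph V) (X : Set V) (x y : V) : Prop :=
  ∃ P : G.Walk x y, P.IsPath ∧ P.length = G.dist x y ∧
    ∀ v ∈ P.support, v ≠ x → v ≠ y → v ∉ X

/-- Dual mutual-visibility set: any two vertices of `X`, and any two vertices outside `X`,
are `X`-visible. -/
def IsDualMutualVisibilitySet {V : Type*} (G : SimpleGraph V) (X : Set V) : Prop :=
  (∀ x ∈ X, ∀ y ∈ X, G.IsVisible X x y) ∧ (∀ x ∉ X, ∀ y ∉ X, G.IsVisible X x y)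

/-- The number `r_i` of dual mutual-visibility sets of cardinality `i`. -/
noncomputable def dualVisibilityCount {V : Type*} [Fintype V] (G : SimpleGraph V) (i : ℕ) : ℕ :=
  {X : Finset V | G.IsDualMutualVisibilitySet (X : Set V) ∧ X.card = i}.ncard

/-- The dual visibility polynomial `∑ r_i x^i`; no vertex set has more than `|V|` elements. -/
noncomputable def dualVisibilityPolynomial {V : Type*} [Fintype V] (G : SimpleGraph V) :
    Polynomial ℕ :=
  ∑ i ∈ Finset.range (Fintype.card V + 1), Polynomial.monomial i (G.dualVisibilityCount i)

end SimpleGraph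

/-!
Two vertices at distance two on the same side of a dual mutual-visibility set `X` must have a common
neighbour outside `X`; this is the only obstruction that matters here. In a graph of girth five, a
vertex `z` of degree at least three cannot lie in `X`: two of its neighbours are on the same side,
and `z` is their only common neighbour. Hence, once a Petersen graph is planted at each vertex of a
set, `X` avoids that set.

Writing `p = 1 + ∑ k, x ^ (e k + 1)`, take for each `k` a clique on `e k + 1` vertices, framed by
vertices carrying planted Petersen graphs. A tip joined to a single clique vertex `s` prevents `X`
from separating `s` from the rest of its clique, and two separators whose common neighbours are the
vertices of two cliques prevent `X` from containing both. So `X` is empty or one of the cliques, and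
each of these is dual: a geodesic that crosses the clique can be rerouted, at no cost, through a
common neighbour outside it.
-/

namespace DualVisibility

open SimpleGraph

section Visibility

variable {V : Type*} {G : SimpleGraph V} {X : Set V} {x y z : V} {m n : ℕ}

theorem isVisible_refl (x : V) : G.IsVisible X x x :=
  ⟨.nil, by simp, by simp, by simp⟩

theorem isVisible_of_adj (h : G.Adj x y) : G.IsVisible X x y := by
  refine ⟨h.toWalk, by simp [h.ne], by simp [dist_eq_one_iff_adj.2 h], ?_⟩
  simp only [Adj.toWalk, Walk.support_cons, Walk.support_nil, List.mem_cons, List.not_mem_nil,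
    or_false]
  tauto

theorem not_commonNeighbors_subset_of_isVisible (h : G.IsVisible X x y) (hxy : G.edist x y = 2) :
    ¬ G.commonNeighbors x y ⊆ X := by
  obtain ⟨P, -, hlen, hPX⟩ := h
  replace hlen : P.length = 2 := by simp [hlen, SimpleGraph.dist, hxy]
  match P, hlen, hPX with
  | .cons e (.cons e' .nil), _, hPX =>
    exact fun hsub ↦ hPX _ (by simp) e.ne' e'.ne (hsub ⟨e, e'.symm⟩)

/-- The trace of dual mutual-visibility on pairs of vertices at distance two: if such a pair lies
entirely inside or entirely outside `X`, then not all its common neighbours are in `X`. -/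
def IsDualAtDistTwo (G : SimpleGraph V) (X : Set V) : Prop :=
  ∀ ⦃x y : V⦄, G.edist x y = 2 → (x ∈ X ↔ y ∈ X) → ¬ G.commonNeighbors x y ⊆ X

theorem isDualAtDistTwo_of_isDualMutualVisibilitySet (h : G.IsDualMutualVisibilitySet X) :
    IsDualAtDistTwo G X := by
  intro x y hxy hside
  refine not_commonNeighbors_subset_of_isVisible ?_ hxy
  by_cases hx : x ∈ X
  · exact h.1 x hx y (hside.1 hx)
  · exact h.2 x hx y (mt hside.2 hx)

/-- `z` has three neighbours at pairwise distance two, any two of which have no common neighbour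
other than `z`. Such a vertex lies in no dual mutual-visibility set. -/
def IsRigidClawCenter (G : SimpleGraph V) (z : V) : Prop :=
  ∃ a : Fin 3 → V, Pairwise fun i j ↦
    G.edist (a i) (a j) = 2 ∧ G.commonNeighbors (a i) (a j) = {z}

theorem IsRigidClawCenter.notMem (hz : IsRigidClawCenter G z) (hX : IsDualAtDistTwo G X) :
    z ∉ X := by
  intro hzX
  obtain ⟨a, ha⟩ := hz
  -- Two of the three neighbours are on the same side of `X`.
  obtain ⟨i, j, hij, hside⟩ :=
    Fintype.exists_ne_map_eq_of_card_lt (fun i ↦ a i ∈ X) (by simp)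
  obtain ⟨hdist, hcommon⟩ := ha hij
  exact hX hdist (iff_of_eq hside) (by simpa [hcommon] using hzX)

theorem isRigidClawCenter_of_isSRGWith [Fintype V] [DecidableRel G.Adj] {k : ℕ}
    (hG : G.IsSRGWith n k 0 1) (hk : 2 < k) (z : V) : IsRigidClawCenter G z := by
  classical
  have hpair (u v : V) (hu : G.Adj z u) (hv : G.Adj z v) (huv : u ≠ v) :
      G.edist u v = 2 ∧ G.commonNeighbors u v = {z} := by
    have hmem : z ∈ G.commonNeighbors u v := ⟨hu.symm, hv.symm⟩
    have hnadj : ¬ G.Adj u v := fun h ↦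
      (Fintype.card_eq_zero_iff.1 (hG.of_adj u v h)).false ⟨z, hmem⟩
    have hcard := hG.of_not_adj huv hnadj
    rw [← Nat.card_eq_fintype_card, Nat.card_coe_set_eq, Set.ncard_eq_one] at hcard
    obtain ⟨w, hw⟩ := hcard
    refine ⟨edist_eq_two_iff.2 ⟨huv, hnadj, z, hmem⟩, ?_⟩
    rw [hw, Set.mem_singleton_iff] at hmem
    rw [hw, hmem]
  have hdeg : 2 < (G.neighborFinset z).card := by
    rwa [card_neighborFinset_eq_degree, hG.regular z]
  obtain ⟨u, v, w, hu, hv, hw, huv, huw, hvw⟩ := Finset.two_lt_card_iff.1 hdeg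
  rw [mem_neighborFinset] at hu hv hw
  refine ⟨![u, v, w], fun i j hij ↦ ?_⟩
  fin_cases i <;> fin_cases j <;>
    first | exact absurd rfl hij | (apply hpair <;> simp [*, Ne.symm])

theorem connected_of_isSRGWith [Fintype V] [Nontrivial V] [DecidableRel G.Adj] {k l m : ℕ}
    (hG : G.IsSRGWith n k l m) (htop : G ≠ ⊤) (hm : m ≠ 0) : G.Connected := by
  classical
  exact connected_of_ediam_ne_top (by simp [hG.ediam_eq_two htop hm])

/-- `y` can be reached from `x` in at most `n` steps without meeting `X`. -/
def ReachesAvoiding (G : SimpleGraph V) (X : Set V) (n : ℕ) (x y : V) : Prop :=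
  ∃ P : G.Walk x y, P.length ≤ n ∧ ∀ v ∈ P.support, v ∉ X

theorem ReachesAvoiding.refl (hx : x ∉ X) (n : ℕ) : ReachesAvoiding G X n x x :=
  ⟨.nil, by simp, by simpa using hx⟩

theorem ReachesAvoiding.mono (h : ReachesAvoiding G X m x y) (hmn : m ≤ n) :
    ReachesAvoiding G X n x y :=
  let ⟨P, hP, hPX⟩ := h
  ⟨P, hP.trans hmn, hPX⟩

theorem ReachesAvoiding.cons (h : ReachesAvoiding G X n z y) (hx : x ∉ X) (hxz : G.Adj x z) :
    ReachesAvoiding G X (n + 1) x y :=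
  let ⟨P, hP, hPX⟩ := h
  ⟨.cons hxz P, by simpa using hP, by simpa using ⟨hx, hPX⟩⟩

theorem ReachesAvoiding.trans (hxz : ReachesAvoiding G X m x z) (hzy : ReachesAvoiding G X n z y) :
    ReachesAvoiding G X (m + n) x y := by
  obtain ⟨P, hP, hPX⟩ := hxz
  obtain ⟨Q, hQ, hQX⟩ := hzy
  refine ⟨P.append Q, by rw [Walk.length_append]; omega, fun v hv ↦ ?_⟩
  rcases Walk.mem_support_append_iff P Q |>.1 hv with hv | hv
  exacts [hPX v hv, hQX v hv]

theorem isVisible_of_reachesAvoiding (h : ReachesAvoiding G X (G.dist x y) x y) :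
    G.IsVisible X x y := by
  obtain ⟨P, hP, hPX⟩ := h
  have hlen : P.length = G.dist x y := hP.antisymm (dist_le P)
  exact ⟨P, P.isPath_of_length_eq_dist hlen, hlen, fun v hv _ _ ↦ hPX v hv⟩

/-- Any two vertices outside `X` with neighbours in `X` are equal, adjacent, or have a common
neighbour outside `X`, so that a walk outside `X` is never forced to be longer. -/
def IsBypassable (G : SimpleGraph V) (X : Set V) : Prop :=
  ∀ ⦃u v s t : V⦄, u ∉ X → v ∉ X → s ∈ X → t ∈ X → G.Adj u s → G.Adj v t → u ≠ v → ¬ G.Adj u v →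
    ¬ G.commonNeighbors u v ⊆ X

theorem IsBypassable.reachesAvoiding_two (hX : IsBypassable G X) {u v s t : V} (hu : u ∉ X)
    (hv : v ∉ X) (hs : s ∈ X) (ht : t ∈ X) (hus : G.Adj u s) (hvt : G.Adj v t) :
    ReachesAvoiding G X 2 u v := by
  rcases eq_or_ne u v with rfl | hne
  · exact .refl hu 2
  by_cases hadj : G.Adj u v
  · exact (ReachesAvoiding.refl hv 1).cons hu hadj
  obtain ⟨w, ⟨huw, hvw⟩, hw⟩ := Set.not_subset.1 (hX hu hv hs ht hus hvt hne hadj)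
  exact ((ReachesAvoiding.refl hv 0).cons hw hvw.symm).cons hu huw

-- The second claim treats a walk that has just entered `X` from `x`, and carries the induction
-- through `X` until the walk leaves it.
theorem IsBypassable.reachesAvoiding_of_walk (hX : IsBypassable G X) (hy : y ∉ X)
    (P : G.Walk z y) :
    (z ∉ X → ReachesAvoiding G X P.length z y) ∧
      (z ∈ X → ∀ x s, x ∉ X → s ∈ X → G.Adj x s → ReachesAvoiding G X (P.length + 1) x y) := by
  induction P with
  | nil => exact ⟨fun h ↦ .refl h _, fun h ↦ absurd h hy⟩
  | @cons z z' y e P ih =>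
    obtain ⟨ih_out, ih_in⟩ := ih hy
    rw [Walk.length_cons]
    refine ⟨fun hz ↦ ?_, fun hz x s hx hs hxs ↦ ?_⟩ <;> by_cases hz' : z' ∈ X
    · exact ih_in hz' z z' hz hz' e
    · exact (ih_out hz').cons hz e
    · exact (ih_in hz' x s hx hs hxs).mono (by omega)
    · exact ((hX.reachesAvoiding_two hx hz' hs hz hxs e.symm).trans (ih_out hz')).mono (by omega)

theorem IsBypassable.isDualMutualVisibilitySet (hX : IsBypassable G X) (hG : G.Connected)
    (hclique : G.IsClique X) : G.IsDualMutualVisibilitySet X := by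
  refine ⟨fun x hx y hy ↦ ?_, fun x hx y hy ↦ ?_⟩
  · rcases eq_or_ne x y with rfl | hne
    · exact isVisible_refl x
    · exact isVisible_of_adj (hclique hx hy hne)
  · obtain ⟨P, hP⟩ := hG.exists_walk_length_eq_dist x y
    exact isVisible_of_reachesAvoiding (hP ▸ (hX.reachesAvoiding_of_walk hy P).1 hx)

end Visibility

section Plant

variable {A T W : Type*} {B : SimpleGraph (A ⊕ T)} {H : SimpleGraph W} {r : W} {Y : Set T}

/-- The embedding of `A ⊕ T` into the vertices of `plant B H r`, sending `a : A` to the root of the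
copy of `H` planted at `a`. -/
def rootEmbedding (A T : Type*) (r : W) : A ⊕ T ↪ A × W ⊕ T :=
  (Function.Embedding.sectL A r).sumMap (.refl T)

@[simp]
theorem rootEmbedding_inl (a : A) : rootEmbedding A T r (.inl a) = .inl (a, r) := rfl

@[simp]
theorem rootEmbedding_inr (t : T) : rootEmbedding A T r (.inr t) = .inr t := rfl

/-- The graph obtained from `B` by planting at each vertex `a : A` a copy of `H`, whose vertex `r`
is identified with `a`; the vertices in `T` are left untouched. -/
def plant (B : SimpleGraph (A ⊕ T)) (H : SimpleGraph W) (r : W) : SimpleGraph (A × W ⊕ T) :=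
  B.map (rootEmbedding A T r) ⊔ ((⊥ □ H) ⊕g ⊥)

@[simp]
theorem plant_adj_rootEmbedding {u v : A ⊕ T} :
    (plant B H r).Adj (rootEmbedding A T r u) (rootEmbedding A T r v) ↔ B.Adj u v := by
  rcases u with a | s <;> rcases v with b | t <;> simp [plant]

@[simp]
theorem plant_adj_copy {a : A} {p q : W} :
    (plant B H r).Adj (.inl (a, p)) (.inl (a, q)) ↔ H.Adj p q := by
  simp [plant]

theorem plant_adj_inl_iff {a : A} {p : W} {w : A × W ⊕ T} :
    (plant B H r).Adj (.inl (a, p)) w ↔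
      (∃ q, H.Adj p q ∧ w = .inl (a, q)) ∨
        p = r ∧ ∃ u, B.Adj (.inl a) u ∧ w = rootEmbedding A T r u := by
  constructor
  · rintro (h | h)
    · obtain ⟨b | s, u, hu, heq, rfl⟩ := (map_adj _ _ _ _).1 h <;> cases heq
      exact .inr ⟨rfl, u, hu, rfl⟩
    · rcases w with ⟨b, q⟩ | t
      · obtain ⟨hpq, rfl⟩ : H.Adj p q ∧ a = b := by simpa using h
        exact .inl ⟨q, hpq, rfl⟩
      · exact absurd h (by simp)
  · rintro (⟨q, hpq, rfl⟩ | ⟨rfl, u, hu, rfl⟩)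
    · exact plant_adj_copy.2 hpq
    · exact plant_adj_rootEmbedding.2 hu

theorem plant_adj_inr_iff {t : T} {w : A × W ⊕ T} :
    (plant B H r).Adj (.inr t) w ↔ ∃ u, B.Adj (.inr t) u ∧ w = rootEmbedding A T r u := by
  constructor
  · rintro (h | h)
    · obtain ⟨a | s, u, hu, heq, rfl⟩ := (map_adj _ _ _ _).1 h <;> cases heq
      exact ⟨u, hu, rfl⟩
    · rcases w with w | s <;> exact absurd h (by simp)
  · rintro ⟨u, hu, rfl⟩
    exact plant_adj_rootEmbedding.2 hu

theorem plant_commonNeighbors_rootEmbedding {u v : A ⊕ T} (huv : u ≠ v) :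
    (plant B H r).commonNeighbors (rootEmbedding A T r u) (rootEmbedding A T r v) =
      rootEmbedding A T r '' B.commonNeighbors u v := by
  ext w
  simp only [mem_commonNeighbors, Set.mem_image]
  constructor
  · rintro ⟨hu, hv⟩
    suffices ∃ z, rootEmbedding A T r z = w by
      obtain ⟨z, rfl⟩ := this
      exact ⟨z, ⟨plant_adj_rootEmbedding.1 hu, plant_adj_rootEmbedding.1 hv⟩, rfl⟩
    rcases u with a | s <;> rcases v with b | t <;>
      grind [rootEmbedding_inl, rootEmbedding_inr, plant_adj_inl_iff, plant_adj_inr_iff]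
  · rintro ⟨z, ⟨hu, hv⟩, rfl⟩
    simp [hu, hv]

theorem plant_commonNeighbors_copy {a : A} {p q : W} (hpq : p ≠ q) :
    (plant B H r).commonNeighbors (.inl (a, p)) (.inl (a, q)) =
      (fun w ↦ .inl (a, w)) '' H.commonNeighbors p q := by
  ext w
  simp only [mem_commonNeighbors, Set.mem_image]
  constructor
  · rintro ⟨hp, hq⟩
    suffices ∃ z, Sum.inl (a, z) = w by
      obtain ⟨z, rfl⟩ := this
      exact ⟨z, ⟨plant_adj_copy.1 hp, plant_adj_copy.1 hq⟩, rfl⟩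
    simp only [plant_adj_inl_iff] at hp hq
    grind
  · rintro ⟨z, ⟨hp, hq⟩, rfl⟩
    exact ⟨plant_adj_copy.2 hp, plant_adj_copy.2 hq⟩

theorem plant_edist_rootEmbedding_eq_two {u v : A ⊕ T} :
    (plant B H r).edist (rootEmbedding A T r u) (rootEmbedding A T r v) = 2 ↔ B.edist u v = 2 := by
  simp only [edist_eq_two_iff, ne_eq, EmbeddingLike.apply_eq_iff_eq, plant_adj_rootEmbedding]
  refine and_congr_right fun huv ↦ ?_
  rw [plant_commonNeighbors_rootEmbedding huv, Set.image_nonempty]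

theorem plant_edist_copy_eq_two {a : A} {p q : W} :
    (plant B H r).edist (.inl (a, p)) (.inl (a, q)) = 2 ↔ H.edist p q = 2 := by
  simp only [edist_eq_two_iff, ne_eq, Sum.inl.injEq, Prod.mk.injEq, true_and, plant_adj_copy]
  refine and_congr_right fun hpq ↦ ?_
  rw [plant_commonNeighbors_copy hpq, Set.image_nonempty]

theorem IsRigidClawCenter.plant {w : W} (hw : IsRigidClawCenter H w) (a : A) :
    IsRigidClawCenter (plant B H r) (.inl (a, w)) := by
  obtain ⟨b, hb⟩ := hw
  refine ⟨fun i ↦ .inl (a, b i), fun i j hij ↦ ⟨plant_edist_copy_eq_two.2 (hb hij).1, ?_⟩⟩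
  have hne : b i ≠ b j := (edist_eq_two_iff.1 (hb hij).1).1
  rw [plant_commonNeighbors_copy hne, (hb hij).2, Set.image_singleton]

theorem plant_connected (hB : B.Connected) (hH : H.Connected) : (plant B H r).Connected := by
  let root : B →g plant B H r := ⟨rootEmbedding A T r, plant_adj_rootEmbedding.2⟩
  let copy (a : A) : H →g plant B H r := ⟨fun w ↦ .inl (a, w), plant_adj_copy.2⟩
  obtain ⟨u⟩ := hB.nonempty
  refine (connected_iff_exists_forall_reachable _).2 ⟨root u, ?_⟩
  rintro (⟨a, w⟩ | t)
  · exact ((hB.preconnected u (.inl a)).map root).trans ((hH.preconnected r w).map (copy a))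
  · exact (hB.preconnected u (.inr t)).map root

theorem rootEmbedding_mem_image_inr {u : A ⊕ T} :
    rootEmbedding A T r u ∈ Sum.inr '' Y ↔ u ∈ Sum.inr '' Y := by
  rcases u with a | t <;> simp

theorem IsDualAtDistTwo.of_plant (h : IsDualAtDistTwo (plant B H r) (Sum.inr '' Y)) :
    IsDualAtDistTwo B (Sum.inr '' Y) := by
  intro x y hxy hside hsub
  refine h (plant_edist_rootEmbedding_eq_two.2 hxy)
    (by rwa [rootEmbedding_mem_image_inr, rootEmbedding_mem_image_inr]) ?_
  rw [plant_commonNeighbors_rootEmbedding (edist_eq_two_iff.1 hxy).1]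
  rintro _ ⟨w, hw, rfl⟩
  exact rootEmbedding_mem_image_inr.2 (hsub hw)

theorem IsBypassable.plant (h : IsBypassable B (Sum.inr '' Y)) :
    IsBypassable (plant B H r) (Sum.inr '' Y) := by
  rintro u v _ _ hu hv ⟨s, hs, rfl⟩ ⟨t, ht, rfl⟩ hus hvt huv hnadj hsub
  obtain ⟨u, husB, rfl⟩ := plant_adj_inr_iff.1 hus.symm
  obtain ⟨v, hvtB, rfl⟩ := plant_adj_inr_iff.1 hvt.symm
  rw [rootEmbedding_mem_image_inr] at hu hv
  rw [plant_adj_rootEmbedding] at hnadj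
  replace huv : u ≠ v := fun h ↦ huv (congrArg _ h)
  refine h hu hv ⟨s, hs, rfl⟩ ⟨t, ht, rfl⟩ husB.symm hvtB.symm huv hnadj fun w hw ↦ ?_
  rw [← rootEmbedding_mem_image_inr (r := r)]
  exact hsub (plant_commonNeighbors_rootEmbedding huv ▸ Set.mem_image_of_mem _ hw)

theorem exists_eq_image_inr_of_isDualMutualVisibilitySet_plant
    (hH : ∀ w, IsRigidClawCenter H w) {X : Set (A × W ⊕ T)}
    (hX : (plant B H r).IsDualMutualVisibilitySet X) :
    ∃ Y : Set T, X = Sum.inr '' Y ∧ IsDualAtDistTwo B (Sum.inr '' Y) := by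
  have hX₂ := isDualAtDistTwo_of_isDualMutualVisibilitySet hX
  have hsub : X ⊆ Set.range Sum.inr := by
    rintro (⟨a, w⟩ | t) hx
    · exact absurd hx (((hH w).plant a).notMem hX₂)
    · exact ⟨t, rfl⟩
  obtain ⟨Y, rfl⟩ := Set.subset_range_iff_exists_image_eq.1 hsub
  exact ⟨Y, rfl, hX₂.of_plant⟩

theorem IsBypassable.isDualMutualVisibilitySet_plant (hY : IsBypassable B (Sum.inr '' Y))
    (hB : B.Connected) (hH : H.Connected) (hclique : B.IsClique (Sum.inr '' Y)) :
    (DualVisibility.plant B H r).IsDualMutualVisibilitySet (Sum.inr '' Y) := by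
  refine hY.plant.isDualMutualVisibilitySet (plant_connected hB hH) ?_
  rintro _ ⟨s, hs, rfl⟩ _ ⟨t, ht, rfl⟩ hst
  rw [← rootEmbedding_inr (r := r) s, ← rootEmbedding_inr (r := r) t, plant_adj_rootEmbedding]
  exact hclique ⟨s, hs, rfl⟩ ⟨t, ht, rfl⟩ (by simpa using hst)

end Plant

section CliqueFrame

variable {K : Type*} {F : K → Type*} {Y : Set (Σ k, F k)}

/-- The vertices framing a set `T` of targets: two hubs, a private tip for each target, and two
separators for each element of `P`. -/
inductive FrameVertex (T P : Type*)
  | hub (i : Bool)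
  | tip (t : T)
  | sep (e : P) (i : Bool)
  deriving Fintype

open FrameVertex

/-- The framework around the cliques: the vertices of `cliqueFrame F` outside the cliques. There is
a pair of separators for each pair of distinct cliques. -/
abbrev Frame (F : K → Type*) : Type _ :=
  FrameVertex (Σ k, F k) {e : Sym2 K // ¬ e.IsDiag}

/-- The adjacencies of `cliqueFrame F`, each listed in one direction only. -/
def frameLink : Frame F ⊕ (Σ k, F k) → Frame F ⊕ (Σ k, F k) → Prop
  | .inl (hub _), .inl (hub _) => True
  | .inl (hub _), .inl (tip _) => True
  | .inl (hub i), .inl (sep _ j) => i = j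
  | .inl (sep d i), .inl (sep e j) => d ≠ e ∧ i ≠ j
  | .inl (tip s), .inr t => s = t
  | .inl (sep e _), .inr t => t.1 ∈ e.1
  | .inr s, .inr t => s.1 = t.1
  | _, _ => False

/-- The graph in which each `F k` is a clique, and the only nonempty sets of clique vertices which
obey the distance-two conditions are the cliques themselves: the tips force a set meeting a clique
to contain it, and the separators forbid it to contain two cliques. The hubs keep these
obstructions from affecting other pairs of vertices. -/
def cliqueFrame (F : K → Type*) : SimpleGraph (Frame F ⊕ Σ k, F k) :=
  .fromRel frameLink

theorem cliqueFrame_connected : (cliqueFrame F).Connected := by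
  have hhub (i : Bool) : (cliqueFrame F).Reachable (.inl (hub false)) (.inl (hub i)) := by
    cases i
    · rfl
    · exact Adj.reachable (by simp [cliqueFrame, frameLink])
  have htip (t : Σ k, F k) : (cliqueFrame F).Reachable (.inl (hub false)) (.inl (tip t)) :=
    Adj.reachable (by simp [cliqueFrame, frameLink])
  refine (connected_iff_exists_forall_reachable _).2 ⟨.inl (hub false), ?_⟩
  rintro ((i | t | ⟨e, i⟩) | t)
  · exact hhub i
  · exact htip t
  · exact (hhub i).trans (Adj.reachable (by simp [cliqueFrame, frameLink]))
  · exact (htip t).trans (Adj.reachable (by simp [cliqueFrame, frameLink]))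

theorem cliqueFrame_commonNeighbors_tip {s t : Σ k, F k} (hst : s ≠ t) (hk : s.1 = t.1) :
    (cliqueFrame F).commonNeighbors (.inl (tip s)) (.inr t) = {.inr s} := by
  ext ((i | u | ⟨e, i⟩) | u) <;>
    grind [mem_commonNeighbors, cliqueFrame, fromRel_adj, frameLink]

theorem cliqueFrame_commonNeighbors_sep (e : {e : Sym2 K // ¬ e.IsDiag}) {i j : Bool}
    (hij : i ≠ j) :
    (cliqueFrame F).commonNeighbors (.inl (sep e i)) (.inl (sep e j)) =
      Sum.inr '' {t | t.1 ∈ e.1} := by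
  have heither (l : Bool) : l = i ∨ l = j := by revert i j l; decide
  ext ((l | u | ⟨d, l⟩) | u)
  · rcases heither l with rfl | rfl <;>
      simp [mem_commonNeighbors, cliqueFrame, frameLink, hij, hij.symm]
  · simp [mem_commonNeighbors, cliqueFrame, frameLink]
  · rcases heither l with rfl | rfl <;> simp [mem_commonNeighbors, cliqueFrame, frameLink]
  · simp [mem_commonNeighbors, cliqueFrame, frameLink]

theorem IsDualAtDistTwo.mem_of_fst_eq (hY : IsDualAtDistTwo (cliqueFrame F) (Sum.inr '' Y))
    {s t : Σ k, F k} (hs : s ∈ Y) (hk : s.1 = t.1) : t ∈ Y := by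
  by_contra ht
  have hst : s ≠ t := fun h ↦ ht (h ▸ hs)
  have hnadj : ¬ (cliqueFrame F).Adj (.inl (tip s)) (.inr t) := by
    simpa [cliqueFrame, frameLink] using hst
  have hcommon := cliqueFrame_commonNeighbors_tip hst hk
  exact hY (edist_eq_two_iff.2 ⟨by simp, hnadj, by simp [hcommon]⟩) (by simpa using ht)
    (by simpa [hcommon] using hs)

theorem IsDualAtDistTwo.fst_eq_of_mem (hY : IsDualAtDistTwo (cliqueFrame F) (Sum.inr '' Y))
    {s t : Σ k, F k} (hs : s ∈ Y) (ht : t ∈ Y) : s.1 = t.1 := by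
  by_contra hst
  let e : {e : Sym2 K // ¬ e.IsDiag} := ⟨s(s.1, t.1), by simpa using hst⟩
  have hnadj : ¬ (cliqueFrame F).Adj (.inl (sep e false)) (.inl (sep e true)) := by
    simp [cliqueFrame, frameLink]
  have hcommon := cliqueFrame_commonNeighbors_sep (F := F) e Bool.false_ne_true
  have hnonempty : {u : Σ k, F k | u.1 ∈ e.1}.Nonempty := ⟨s, Sym2.mem_mk_left _ _⟩
  refine hY (edist_eq_two_iff.2 ⟨by simp, hnadj, hcommon ▸ hnonempty.image _⟩) (by simp) ?_
  rw [hcommon]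
  refine Set.image_mono fun u hu ↦ ?_
  rcases Sym2.mem_iff.1 hu with hu | hu
  exacts [hY.mem_of_fst_eq hs hu.symm, hY.mem_of_fst_eq ht hu.symm]

theorem IsDualAtDistTwo.eq_empty_or_eq_range
    (hY : IsDualAtDistTwo (cliqueFrame F) (Sum.inr '' Y)) :
    Y = ∅ ∨ ∃ k, Y = Set.range (Sigma.mk k) := by
  refine Y.eq_empty_or_nonempty.imp_right ?_
  rintro ⟨⟨k, a⟩, ha⟩
  refine ⟨k, Set.Subset.antisymm ?_ (Set.range_subset_iff.2 fun b ↦ hY.mem_of_fst_eq ha rfl)⟩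
  rintro ⟨l, b⟩ hb
  obtain rfl : k = l := hY.fst_eq_of_mem ha hb
  exact ⟨b, rfl⟩

theorem cliqueFrame_isClique (k : K) :
    (cliqueFrame F).IsClique (Sum.inr '' Set.range (Sigma.mk k)) := by
  rintro _ ⟨_, ⟨a, rfl⟩, rfl⟩ _ ⟨_, ⟨b, rfl⟩, rfl⟩ hab
  simpa [cliqueFrame, frameLink] using hab

theorem not_cliqueFrame_commonNeighbors_sep_subset [∀ k, Nonempty (F k)]
    (e : {e : Sym2 K // ¬ e.IsDiag}) {i j : Bool} (hij : i ≠ j) (k : K) :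
    ¬ (cliqueFrame F).commonNeighbors (.inl (sep e i)) (.inl (sep e j)) ⊆
      Sum.inr '' Set.range (Sigma.mk k) := by
  obtain ⟨l, hle, hlk⟩ : ∃ l ∈ e.1, l ≠ k := by
    by_cases hk : k ∈ e.1
    · exact ⟨Sym2.Mem.other hk, Sym2.other_mem hk, Sym2.other_ne e.2 hk⟩
    · exact ⟨e.1.out.1, e.1.out_fst_mem, fun h ↦ hk (h ▸ e.1.out_fst_mem)⟩
  obtain ⟨b⟩ : Nonempty (F l) := inferInstance
  rw [cliqueFrame_commonNeighbors_sep e hij, Set.image_subset_image_iff Sum.inr_injective]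
  intro hsub
  obtain ⟨a, ha⟩ := hsub (show (⟨l, b⟩ : Σ k, F k).1 ∈ e.1 from hle)
  exact hlk (congrArg Sigma.fst ha).symm

theorem cliqueFrame_eq_tip_or_eq_sep_of_adj {k : K} {a : F k} {u : Frame F ⊕ Σ k, F k}
    (hu : u ∉ Sum.inr '' Set.range (Sigma.mk k)) (hua : (cliqueFrame F).Adj u (.inr ⟨k, a⟩)) :
    (∃ t, u = .inl (tip t)) ∨ ∃ e i, u = .inl (sep e i) := by
  rcases u with (i | t | ⟨e, i⟩) | ⟨l, b⟩
  · simp [cliqueFrame, frameLink] at hua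
  · exact .inl ⟨t, rfl⟩
  · exact .inr ⟨e, i, rfl⟩
  · obtain rfl : l = k := by
      have := hua.2
      simpa [frameLink, eq_comm] using this
    exact absurd ⟨_, ⟨b, rfl⟩, rfl⟩ hu

theorem cliqueFrame_isBypassable [∀ k, Nonempty (F k)] (k : K) :
    IsBypassable (cliqueFrame F) (Sum.inr '' Set.range (Sigma.mk k)) := by
  have via_hub (i : Bool) {u v : Frame F ⊕ Σ k, F k} (hu : (cliqueFrame F).Adj u (.inl (hub i)))
      (hv : (cliqueFrame F).Adj v (.inl (hub i))) :
      ¬ (cliqueFrame F).commonNeighbors u v ⊆ Sum.inr '' Set.range (Sigma.mk k) :=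
    Set.not_subset.2 ⟨.inl (hub i), ⟨hu, hv⟩, by simp⟩
  have tip_adj_hub (t : Σ k, F k) (i : Bool) :
      (cliqueFrame F).Adj (.inl (tip t)) (.inl (hub i)) := by simp [cliqueFrame, frameLink]
  have sep_adj_hub (e : {e : Sym2 K // ¬ e.IsDiag}) (i : Bool) :
      (cliqueFrame F).Adj (.inl (sep e i)) (.inl (hub i)) := by simp [cliqueFrame, frameLink]
  rintro u v _ _ hu hv ⟨_, ⟨a, rfl⟩, rfl⟩ ⟨_, ⟨b, rfl⟩, rfl⟩ hua hvb - hnadj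
  rcases cliqueFrame_eq_tip_or_eq_sep_of_adj hu hua with ⟨s, rfl⟩ | ⟨d, i, rfl⟩ <;>
    rcases cliqueFrame_eq_tip_or_eq_sep_of_adj hv hvb with ⟨t, rfl⟩ | ⟨e, j, rfl⟩
  · exact via_hub false (tip_adj_hub s false) (tip_adj_hub t false)
  · exact via_hub j (tip_adj_hub s j) (sep_adj_hub e j)
  · exact via_hub i (sep_adj_hub d i) (tip_adj_hub t i)
  · rcases eq_or_ne i j with rfl | hij
    · exact via_hub i (sep_adj_hub d i) (sep_adj_hub e i)
    · obtain rfl : d = e := by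
        by_contra hde
        exact hnadj (by simp [cliqueFrame, frameLink, hde, hij])
      exact not_cliqueFrame_commonNeighbors_sep_subset d hij k

end CliqueFrame

section VisibilityPolynomial

open Polynomial

theorem dualVisibilityPolynomial_eq_sum {V : Type*} [Fintype V] {G : SimpleGraph V}
    {𝒮 : Finset (Finset V)} (h𝒮 : ∀ S, S ∈ 𝒮 ↔ G.IsDualMutualVisibilitySet (S : Set V)) :
    G.dualVisibilityPolynomial = ∑ S ∈ 𝒮, X ^ S.card := by
  have hcount (i : ℕ) : G.dualVisibilityCount i = ∑ S ∈ 𝒮, if i = S.card then 1 else 0 := by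
    rw [dualVisibilityCount, ← Finset.card_filter, ← Set.ncard_coe_finset]
    simp [h𝒮, eq_comm]
  ext i
  simp only [dualVisibilityPolynomial, finsetSum_coeff, coeff_monomial, coeff_X_pow,
    Finset.sum_ite_eq', Finset.mem_range, Nat.lt_succ_iff, ← hcount, ite_eq_left_iff]
  intro hi
  rw [hcount]
  refine (Finset.sum_eq_zero fun S _ ↦ if_neg ?_).symm
  rintro rfl
  exact hi S.card_le_univ

variable {K : Type*} {F : K → Type*} {W : Type*} {H : SimpleGraph W} {r : W}

theorem isDualMutualVisibilitySet_plant_cliqueFrame_iff [∀ k, Nonempty (F k)]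
    (hH : H.Connected) (hclaw : ∀ w, IsRigidClawCenter H w) {S : Set (Frame F × W ⊕ Σ k, F k)} :
    (plant (cliqueFrame F) H r).IsDualMutualVisibilitySet S ↔
      S = ∅ ∨ ∃ k, S = Sum.inr '' Set.range (Sigma.mk k) := by
  constructor
  · intro hS
    obtain ⟨Y, rfl, hY⟩ := exists_eq_image_inr_of_isDualMutualVisibilitySet_plant hclaw hS
    rcases hY.eq_empty_or_eq_range with rfl | ⟨k, rfl⟩
    exacts [.inl (Set.image_empty _), .inr ⟨k, rfl⟩]
  · rintro (rfl | ⟨k, rfl⟩)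
    · rw [← Set.image_empty Sum.inr]
      exact IsBypassable.isDualMutualVisibilitySet_plant (by simp [IsBypassable])
        cliqueFrame_connected hH (by simp)
    · exact (cliqueFrame_isBypassable k).isDualMutualVisibilitySet_plant cliqueFrame_connected hH
        (cliqueFrame_isClique k)

theorem dualVisibilityPolynomial_plant_cliqueFrame [Fintype K] [DecidableEq K]
    [∀ k, Fintype (F k)] [∀ k, Nonempty (F k)] [Fintype W]
    (hH : H.Connected) (hclaw : ∀ w, IsRigidClawCenter H w) :
    (plant (cliqueFrame F) H r).dualVisibilityPolynomial =
      1 + ∑ k, X ^ Fintype.card (F k) := by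
  classical
  let clique (k : K) : Finset (Frame F × W ⊕ Σ k, F k) :=
    Finset.univ.map ((Function.Embedding.sigmaMk k).trans .inr)
  have hcoe (k : K) : (clique k : Set (Frame F × W ⊕ Σ k, F k)) =
      Sum.inr '' Set.range (Sigma.mk k) := by
    ext
    simp [clique]
  have hcard (k : K) : (clique k).card = Fintype.card (F k) := by simp [clique]
  have hinj : Function.Injective clique := by
    intro k l hkl
    obtain ⟨a⟩ : Nonempty (F k) := inferInstance
    have ha : Sum.inr ⟨k, a⟩ ∈ clique l := hkl ▸ by simp [clique]
    obtain ⟨b, -, hb⟩ := Finset.mem_map.1 ha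
    exact (congrArg Sigma.fst (Sum.inr_injective hb)).symm
  have hempty : ∅ ∉ Finset.univ.image clique := by
    simp [clique, Finset.univ_eq_empty_iff]
  have hdual (S : Finset (Frame F × W ⊕ Σ k, F k)) : S ∈ insert ∅ (Finset.univ.image clique) ↔
      (plant (cliqueFrame F) H r).IsDualMutualVisibilitySet (S : Set _) := by
    simp only [isDualMutualVisibilitySet_plant_cliqueFrame_iff hH hclaw, ← hcoe,
      Finset.coe_inj, Finset.coe_eq_empty, Finset.mem_insert, Finset.mem_image,
      Finset.mem_univ, true_and, eq_comm (b := S)]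
  rw [dualVisibilityPolynomial_eq_sum hdual, Finset.sum_insert hempty,
    Finset.sum_image hinj.injOn]
  simp only [Finset.card_empty, pow_zero, hcard]

theorem exists_eq_sum_X_pow (p : ℕ[X]) :
    ∃ (K : Type) (_ : Fintype K) (e : K → ℕ), p = ∑ k, X ^ e k := by
  induction p using Polynomial.induction_on' with
  | add p q hp hq =>
    obtain ⟨K, _, e, rfl⟩ := hp
    obtain ⟨L, _, f, rfl⟩ := hq
    exact ⟨K ⊕ L, inferInstance, Sum.elim e f, by simp⟩
  | monomial n a =>
    exact ⟨Fin a, inferInstance, fun _ ↦ n, by simp [← C_mul_X_pow_eq_monomial]⟩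

end VisibilityPolynomial

section Petersen

/-- The Petersen graph, as the Kneser graph of the two-element subsets of a five-element set. -/
def petersenGraph : SimpleGraph {s : Finset (Fin 5) // s.card = 2} where
  Adj s t := Disjoint s.1 t.1
  symm := ⟨fun _ _ h ↦ h.symm⟩
  loopless := ⟨fun s h ↦ by simpa [disjoint_self.1 h] using s.2⟩

instance : DecidableRel petersenGraph.Adj := fun s t ↦
  inferInstanceAs (Decidable (Disjoint s.1 t.1))

theorem petersenGraph_isSRGWith : petersenGraph.IsSRGWith 10 3 0 1 where
  card := by decide +kernel
  regular := by unfold IsRegularOfDegree; decide +kernel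
  of_adj := by decide +kernel
  of_not_adj := by unfold Pairwise; decide +kernel

theorem petersenGraph_connected : petersenGraph.Connected := by
  have : Nontrivial {s : Finset (Fin 5) // s.card = 2} :=
    ⟨⟨{0, 1}, rfl⟩, ⟨{0, 2}, rfl⟩, by decide⟩
  have htop : petersenGraph ≠ ⊤ := by
    intro h
    have hadj : petersenGraph.Adj ⟨{0, 1}, rfl⟩ ⟨{0, 2}, rfl⟩ := by rw [h]; decide
    exact absurd hadj (by decide)
  exact connected_of_isSRGWith petersenGraph_isSRGWith htop one_ne_zero

theorem petersenGraph_isRigidClawCenter (z : {s : Finset (Fin 5) // s.card = 2}) :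
    IsRigidClawCenter petersenGraph z :=
  isRigidClawCenter_of_isSRGWith petersenGraph_isSRGWith (by norm_num) z

end Petersen

end DualVisibility

open DualVisibility

theorem mainTheorem2 (p : Polynomial ℕ) (hp : p.coeff 0 = 1) :
    ∃ (V : Type) (_ : Fintype V) (G : SimpleGraph V),
      G.Connected ∧ G.dualVisibilityPolynomial = p := by
  classical
  obtain ⟨K, _, e, he⟩ := exists_eq_sum_X_pow p.divX
  let F (k : K) : Type := Fin (e k + 1)
  let G := plant (cliqueFrame F) petersenGraph ⟨{0, 1}, rfl⟩
  refine ⟨_, inferInstance, G, plant_connected cliqueFrame_connected petersenGraph_connected, ?_⟩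
  calc G.dualVisibilityPolynomial
      = 1 + ∑ k, Polynomial.X ^ Fintype.card (F k) :=
        dualVisibilityPolynomial_plant_cliqueFrame petersenGraph_connected
          petersenGraph_isRigidClawCenter
    _ = p.divX * Polynomial.X + Polynomial.C (p.coeff 0) := by
        simp [F, he, hp, Finset.sum_mul, pow_succ, add_comm]
    _ = p := p.divX_mul_X_add
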